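/- Conventions. Rings are associative, not necessarily unital or commutative; compact spaces and topological groups are Hausdorff. A \emph{compact $G$-ring} is a pair $(R,G)$ where $R$ is a compact Hausdorff topological ring and $G$ is a Polish group acting faithfully and (jointly) continuously on $R$ by ring automorphisms (so stabilizers of points are closed). It is \emph{small} if for every $n\in\omega$ there are only countably many $G$-orbits on $R^n$. For $A\subseteq R$ finite let $G_A$ be the pointwise stabilizer of $A$ in $G$ and $o(a/A)=G_A\cdot a$. For finite $A,B\subseteq R$ and $a\in R$, say that $a$ is \emph{$nm$-independent from $B$ over $A$} if $\{g\in G_A: ga\in o(a/A\cup B)\}$ is non-meager in $G_A$. An element $a\in R$ is \emph{$nm$-generic over} a finite set $A\subseteq R$ if for every $b\in R$ such that $a$ is $nm$-independent from $\{b\}$ over $A$, the element $b+a$ is $nm$-independent from $A\cup\{b\}$ over $\emptyset$; it is \emph{$nm$-generic} if it is $nm$-generic over $\emptyset$. The \emph{left annihilator} of $g\in R$ is $\{r\in R: rg=0\}$. $R$ is \emph{null-by-finite} if it has a two-sided ideal $I$ of finite index with $xy=0$ for all $x,y\in I$. Lemma. Let $(R,G)$ be a small compact $G$-ring, and let $g\in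 R$ be $nm$-generic over some finite set $A\subseteq R$ (in particular, $g$ may be any $nm$-generic element, $A=\emptyset$). If the left annihilator of $g$ is open in $R$, then $R$ is null-by-finite. -/

import Mathlib

/-- `(X, G)` is a Polish structure: `G` is a Polish group acting faithfully on the set `X` so that
the stabilizers of all singletons are closed subgroups of `G`. -/
structure IsPolishStructure (X G : Type*) [Group G] [TopologicalSpace G] [MulAction G X] :
    Prop where
  isTopologicalGroup : IsTopologicalGroup G
  polishSpace : PolishSpace G
  faithfulSMul : FaithfulSMul G X
  isClosed_stabilizer : ∀ x : X, IsClosed (MulAction.stabilizer G x : Set G)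

/-- `(X, G)` is small: for every `n`, there are only countably many orbits of `G` on `X ^ n`. -/
def IsSmallStructure (X G : Type*) [Group G] [MulAction G X] : Prop :=
  ∀ n : ℕ, Countable (MulAction.orbitRel.Quotient G (Fin n → X))

/-- `(R, G)` is a compact `G`-ring: a Polish structure in which `R` is a compact Hausdorff
topological ring (associative, not necessarily unital or commutative) on which `G` acts
(jointly) continuously and by ring automorphisms. -/
structure IsCompactGRing (R G : Type*) [NonUnitalRing R] [TopologicalSpace R]
    [Group G] [TopologicalSpace G] [MulAction G R] : Prop extends IsPolishStructure R G where
  isTopologicalRing : IsTopologicalRing R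
  t2Space : T2Space R
  compactSpace : CompactSpace R
  continuousSMul : ContinuousSMul G R
  smul_add : ∀ (g : G) (r s : R), g • (r + s) = g • r + g • s
  smul_mul : ∀ (g : G) (r s : R), g • (r * s) = (g • r) * (g • s)

/-- The orbit `o(a/A)` of `a` under the pointwise stabilizer `G_A` of `A`. Here `a` may be an
element of `X` or a tuple of elements of `X`, that is `Y` may be `X` or `Fin n → X`. -/
def orbitOver (G : Type*) {X Y : Type*} [Group G] [MulAction G X] [MulAction G Y]
    (a : Y) (A : Set X) : Set Y :=
  {y | ∃ g ∈ fixingSubgroup G A, g • a = y}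

/-- `a` is nm-independent from `B` over `A`: with `π_A : G_A → o(a/A)`, `π_A g = g • a`, the
preimage of `o(a/A ∪ B)` under `π_A` is a nonmeager subset of the topological space `G_A`. -/
def NMIndep (G : Type*) {X Y : Type*} [Group G] [TopologicalSpace G] [MulAction G X]
    [MulAction G Y] (a : Y) (A B : Set X) : Prop :=
  ¬ IsMeagre {g : fixingSubgroup G A | (g : G) • a ∈ orbitOver G a (A ∪ B)}

/-- `a` is nm-generic over `A`, with respect to the additive group of `R`: for all `b` such that
`a` is nm-independent from `b` over `A`, `b + a` is nm-independent from `A, b` (over `∅`). -/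
def IsNMGenericOver (G : Type*) {R : Type*} [Group G] [TopologicalSpace G] [AddGroup R]
    [MulAction G R] (a : R) (A : Set R) : Prop :=
  ∀ b : R, NMIndep G a A {b} → NMIndep G (b + a) ∅ (A ∪ {b})

/-- The left annihilator of an element `g`. -/
def leftAnnihilator {R : Type*} [NonUnitalRing R] (g : R) : Set R :=
  {r | r * g = 0}

/-- A ring is null-by-finite if it has a null (two-sided) ideal of finite index. -/
def IsNullByFinite (R : Type*) [NonUnitalRing R] : Prop :=
  ∃ I : TwoSidedIdeal R, (∀ x ∈ I, ∀ y ∈ I, x * y = 0) ∧ Finite I.ringCon.Quotient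

/-!
Baire category, applied to a Polish group acting on a compact space, shows two things.

First, the `G`-orbit of an nm-generic `g` over `A` is nonmeagre in `R`. By smallness, `R` is covered
by countably many orbits of `G_A`, so one of them, `o(b/A)`, is nonmeagre; `G_A` itself is covered by
countably many double cosets of `G_{A ∪ {g}}` and `G_{A ∪ {b}}`, so after moving `b` inside `o(b/A)`
the product `G_{A ∪ {g}} * G_{A ∪ {b}}` is nonmeagre in `G_A`. Inverting this product shows that `g`
is nm-independent from `b` over `A`, hence that `b + g` is nm-independent from `A ∪ {b}`. The
passage between category in the group and category in `R` is `isMeagre_setOf_smul_mem`: when the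
orbit of `x` is nonmeagre, the preimage of a meagre set under the orbit map of `x` is meagre. It
gives in turn that `o(b/A ∪ {g})`, the orbit of `b + g`, `o(b + g/A ∪ {b}) = b + o(g/A ∪ {b})`, and
so the orbit of `g`, are nonmeagre.

Secondly, let `U` be the left annihilator of `g`, and suppose that it is open. The elements of `G`
that carry `g` into the right annihilator of `U` form a neighbourhood of `1`, because `U` is compact
open. As the orbit of `g` is nonmeagre, the right annihilator of `U`, a closed subgroup, is then
nonmeagre, hence open. Its intersection with `U` is an open null subgroup, and compactness of `R`
yields an open two-sided ideal inside it.
-/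

open Set Topology Filter

/-! ### Category and orbit maps -/

/-- If the orbit of `x` is nonmeagre, the orbit map of `x` pulls meagre sets back to meagre sets.
This needs only second countability of the group, not that the orbit map be open onto its image. -/
lemma isMeagre_setOf_smul_mem {H X : Type*} [Group H] [TopologicalSpace H]
    [IsTopologicalGroup H] [SecondCountableTopology H] [TopologicalSpace X] [MulAction H X]
    [ContinuousSMul H X] {x : X} {M : Set X} (hM : IsMeagre M)
    (hx : ¬ IsMeagre (MulAction.orbit H x)) : IsMeagre {h : H | h • x ∈ M} := by
  obtain ⟨S, hS, hSc, hMS⟩ := isMeagre_iff_countable_union_isNowhereDense.1 hM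
  refine (isMeagre_biUnion hSc (f := fun t => {h : H | h • x ∈ closure t})
    fun t ht => ?_).mono ?_
  · refine IsNowhereDense.isMeagre ?_
    have hcl : IsClosed {h : H | h • x ∈ closure t} :=
      isClosed_closure.preimage (by fun_prop : Continuous fun h : H => h • x)
    rw [hcl.isNowhereDense_iff, ← not_nonempty_iff_eq_empty]
    rintro ⟨v, hv⟩
    -- Countably many translates of the interior cover `H`, so countably many translates of
    -- `closure t` cover the orbit.
    obtain ⟨s, hs, hcov⟩ := TopologicalSpace.countable_cover_nhds
      (f := fun h : H => {k | v * h⁻¹ * k ∈ interior {h : H | h • x ∈ closure t}}) fun h =>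
        (isOpen_interior.preimage (by fun_prop)).mem_nhds (by simpa using hv)
    refine hx ((isMeagre_biUnion hs (f := fun h => (fun y => (h * v⁻¹) • y) '' closure t)
      fun h _ => ?_).mono ?_)
    · exact (Homeomorph.smul (h * v⁻¹)).isInducing.isMeagre_image (hS t ht).closure.isMeagre
    · rintro _ ⟨k, rfl⟩
      obtain ⟨h, hh, hk⟩ := mem_iUnion₂.1 (hcov.symm ▸ mem_univ k)
      refine mem_iUnion₂.2 ⟨h, hh, (v * h⁻¹ * k) • x,
        (interior_subset hk : v * h⁻¹ * k ∈ {h : H | h • x ∈ closure t}), ?_⟩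
      simp [smul_smul, mul_assoc]
  · intro h hh
    obtain ⟨t, ht, hxt⟩ := hMS hh
    exact mem_iUnion₂.2 ⟨t, ht, subset_closure hxt⟩

/-! ### Small structures -/

lemma IsSmallStructure.exists_countable_cover {X G : Type*} [Group G] [MulAction G X]
    (h : IsSmallStructure X G) {A : Set X} (hA : A.Finite) :
    ∃ S : Set X, S.Countable ∧ ∀ x, ∃ s ∈ S, x ∈ orbitOver G s A := by
  obtain ⟨n, a, ha⟩ : ∃ (n : ℕ) (a : Fin n → X), range a = A := by
    have := hA.to_subtype
    obtain ⟨n, ⟨e⟩⟩ := Finite.exists_equiv_fin A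
    exact ⟨n, fun i => (e.symm i : X), by
      rw [range_comp' Subtype.val e.symm, e.symm.surjective.range_eq, image_univ,
        Subtype.range_coe]⟩
  have := h (n + 1)
  let f : X → MulAction.orbitRel.Quotient G (Fin (n + 1) → X) := fun x =>
    Quotient.mk _ (Fin.cons x a : Fin (n + 1) → X)
  obtain ⟨S, -, hS⟩ := exists_subset_bijOn univ f
  refine ⟨S, (mapsTo_univ f S).countable_of_injOn hS.injOn (to_countable _), fun x => ?_⟩
  obtain ⟨s, hs, hsx⟩ := hS.surjOn (mem_image_of_mem f (mem_univ x))
  refine ⟨s, hs, ?_⟩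
  obtain ⟨k, hk⟩ := MulAction.orbitRel_apply.1 (Quotient.exact hsx.symm)
  refine ⟨k, ?_, by simpa using congrFun hk 0⟩
  rw [mem_fixingSubgroup_iff, ← ha]
  rintro _ ⟨i, rfl⟩
  simpa using congrFun hk i.succ

lemma IsPolishStructure.isClosed_fixingSubgroup {X G : Type*} [Group G] [TopologicalSpace G]
    [MulAction G X] (h : IsPolishStructure X G) (A : Set X) :
    IsClosed (fixingSubgroup G A : Set G) := by
  have : (fixingSubgroup G A : Set G) = ⋂ a ∈ A, (MulAction.stabilizer G a : Set G) := by
    ext; simp [mem_fixingSubgroup_iff]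
  rw [this]
  exact isClosed_biInter fun a _ => h.isClosed_stabilizer a

/-! ### Generic elements have nonmeagre orbits -/

/-- In a small compact `G`-ring there is an element with nonmeagre orbit over `A ∪ {g}` from which
`g` is nm-independent over `A`. -/
lemma IsCompactGRing.exists_nmIndep {R G : Type*} [NonUnitalRing R] [TopologicalSpace R]
    [Group G] [TopologicalSpace G] [MulAction G R]
    (hR : IsCompactGRing R G) (hsmall : IsSmallStructure R G)
    {A : Set R} (hA : A.Finite) (g : R) :
    ∃ b : R, NMIndep G g A {b} ∧ ¬ IsMeagre (orbitOver G b (A ∪ {g})) := by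
  have := hR.isTopologicalGroup
  have := hR.polishSpace
  have := hR.continuousSMul
  have := hR.compactSpace
  have := hR.t2Space
  have : PolishSpace (fixingSubgroup G A) := (hR.isClosed_fixingSubgroup A).polishSpace
  obtain ⟨S, hSc, hS⟩ := hsmall.exists_countable_cover hA
  obtain ⟨b, -, hb⟩ : ∃ b ∈ S, ¬ IsMeagre (orbitOver G b A) := by
    refine exists_of_not_isMeagre_biUnion hSc fun h => ?_
    exact not_isMeagre_of_isOpen isOpen_univ ⟨(0 : R), mem_univ _⟩
      (h.mono fun x _ => by simpa using hS x)
  have hb' : ¬ IsMeagre (MulAction.orbit (fixingSubgroup G A) b) := by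
    refine fun h => hb (h.mono ?_)
    rintro _ ⟨k, hk, rfl⟩
    exact ⟨⟨k, hk⟩, rfl⟩
  obtain ⟨T, hTc, hT⟩ := hsmall.exists_countable_cover (hA.union (finite_singleton g))
  obtain ⟨c, -, hc⟩ : ∃ c ∈ T,
      ¬ IsMeagre {h : fixingSubgroup G A | h • b ∈ orbitOver G c (A ∪ {g})} := by
    refine exists_of_not_isMeagre_biUnion hTc fun h => ?_
    exact not_isMeagre_of_isOpen isOpen_univ ⟨(1 : fixingSubgroup G A), mem_univ _⟩
      (h.mono fun x _ => by simpa using hT (x • b))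
  refine ⟨c, fun hm => hc ?_, fun hm => hc (isMeagre_setOf_smul_mem hm hb')⟩
  obtain ⟨h₀, k₀, hk₀, h₀c⟩ := nonempty_of_not_isMeagre hc
  have hk₀A : k₀ ∈ fixingSubgroup G A := fixingSubgroup_antitone G R subset_union_left hk₀
  -- Since `b = h₀⁻¹ • k₀ • c`, the set for `b` is `G_{A ∪ {g}} * G_{A ∪ {c}} * (h₀⁻¹ * k₀)⁻¹`, which
  -- the homeomorphism `e` carries to `G_{A ∪ {c}} * G_{A ∪ {g}}`, the set defining independence.
  let e : fixingSubgroup G A ≃ₜ fixingSubgroup G A :=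
    (Homeomorph.mulRight (h₀⁻¹ * ⟨k₀, hk₀A⟩)).trans (Homeomorph.inv _)
  refine (hm.preimage_of_isOpenMap e.continuous e.isOpenMap).mono ?_
  rintro h ⟨k, hk, hkc⟩
  have hbc : (h₀⁻¹ : G) • k₀ • c = b := by
    rw [h₀c]; exact inv_smul_smul (h₀ : G) b
  have he : ((e h : fixingSubgroup G A) : G) = ((h : G) * ((h₀ : G)⁻¹ * k₀))⁻¹ := rfl
  have hkA : k ∈ fixingSubgroup G A := fixingSubgroup_antitone G R subset_union_left hk
  have hfix : ((h : G) * ((h₀ : G)⁻¹ * k₀)) • c = k • c := by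
    rw [mul_smul, mul_smul, hbc, hkc]; rfl
  refine ⟨(e h : G) * k, ?_, ?_⟩
  · rw [mem_fixingSubgroup_iff]
    rintro y (hy | rfl)
    · exact (mem_fixingSubgroup_iff G).1 (mul_mem (e h).2 hkA) y hy
    · rw [mul_smul, ← hfix, he, inv_smul_smul]
  · rw [mul_smul, (mem_fixingSubgroup_iff G).1 hk g (Or.inr rfl)]

lemma IsNMGenericOver.not_isMeagre_orbit {R G : Type*} [NonUnitalRing R] [TopologicalSpace R]
    [Group G] [TopologicalSpace G] [MulAction G R]
    (hR : IsCompactGRing R G) (hsmall : IsSmallStructure R G)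
    {A : Set R} (hA : A.Finite) {g : R} (hg : IsNMGenericOver G g A) :
    ¬ IsMeagre (MulAction.orbit G g) := by
  have := hR.isTopologicalGroup
  have := hR.polishSpace
  have := hR.continuousSMul
  have := hR.isTopologicalRing
  have : PolishSpace (fixingSubgroup G (∅ : Set R)) := (hR.isClosed_fixingSubgroup ∅).polishSpace
  obtain ⟨b, hgb, hb⟩ := hR.exists_nmIndep hsmall hA g
  have hsum : ¬ IsMeagre (MulAction.orbit (fixingSubgroup G (∅ : Set R)) (b + g)) := by
    refine fun h => hb ((h.preimage_of_isOpenMap (Homeomorph.addRight g).continuous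
      (Homeomorph.addRight g).isOpenMap).mono ?_)
    rintro _ ⟨k, hk, rfl⟩
    refine ⟨⟨k, fixingSubgroup_antitone G R (empty_subset _) hk⟩, ?_⟩
    change k • (b + g) = k • b + g
    rw [hR.smul_add, (mem_fixingSubgroup_iff G).1 hk g (Or.inr rfl)]
  intro hm
  refine hg b hgb (isMeagre_setOf_smul_mem (H := fixingSubgroup G (∅ : Set R)) ?_ hsum)
  refine (hm.preimage_of_isOpenMap (Homeomorph.addLeft (-b)).continuous
    (Homeomorph.addLeft (-b)).isOpenMap).mono ?_
  rintro _ ⟨k, hk, rfl⟩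
  refine ⟨k, ?_⟩
  change k • g = -b + k • (b + g)
  rw [hR.smul_add, (mem_fixingSubgroup_iff G).1 hk b (Or.inr (Or.inr rfl)), neg_add_cancel_left]

/-! ### Annihilators and open ideals -/

/-- The left annihilator of an element, as an additive subgroup. -/
def leftAnnihilatorAddSubgroup {R : Type*} [NonUnitalRing R] (g : R) : AddSubgroup R :=
  (AddMonoidHom.mulRight g).ker

/-- The right annihilator of a set, as an additive subgroup. -/
def rightAnnihilator {R : Type*} [NonUnitalRing R] (U : Set R) : AddSubgroup R :=
  ⨅ u ∈ U, (AddMonoidHom.mulLeft u).ker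

lemma mem_rightAnnihilator {R : Type*} [NonUnitalRing R] {U : Set R} {x : R} :
    x ∈ rightAnnihilator U ↔ ∀ u ∈ U, u * x = 0 := by
  simp [rightAnnihilator, AddSubgroup.mem_iInf, AddMonoidHom.mem_ker]

lemma isClosed_rightAnnihilator {R : Type*} [NonUnitalRing R] [TopologicalSpace R]
    [IsTopologicalRing R] [T2Space R] (U : Set R) : IsClosed (rightAnnihilator U : Set R) := by
  have : (rightAnnihilator U : Set R) = ⋂ u ∈ U, {x | u * x = 0} := by
    ext; simp [mem_rightAnnihilator]
  rw [this]
  exact isClosed_biInter fun u _ => isClosed_eq (by fun_prop) (by fun_prop)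

/-- The largest two-sided ideal contained in an additive subgroup `W`. As there may be no unit,
membership of `x` itself and of all one-sided and two-sided multiples of `x` in `W` is required. -/
def idealCore {R : Type*} [NonUnitalRing R] (W : AddSubgroup R) : TwoSidedIdeal R :=
  TwoSidedIdeal.mk' {x | x ∈ W ∧ (∀ r, r * x ∈ W) ∧ (∀ s, x * s ∈ W) ∧ ∀ r s, r * x * s ∈ W}
    (by simp)
    (fun hx hy => ⟨W.add_mem hx.1 hy.1,
      fun r => by rw [mul_add]; exact W.add_mem (hx.2.1 r) (hy.2.1 r),
      fun s => by rw [add_mul]; exact W.add_mem (hx.2.2.1 s) (hy.2.2.1 s),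
      fun r s => by rw [mul_add, add_mul]; exact W.add_mem (hx.2.2.2 r s) (hy.2.2.2 r s)⟩)
    (fun hx => by simpa using hx)
    (fun {x y} hy => ⟨hy.2.1 x, fun r => by rw [← mul_assoc]; exact hy.2.1 _,
      fun s => hy.2.2.2 x s, fun r s => by rw [← mul_assoc]; exact hy.2.2.2 _ s⟩)
    (fun {x y} hx => ⟨hx.2.2.1 y, fun r => by rw [← mul_assoc]; exact hx.2.2.2 r y,
      fun s => by rw [mul_assoc]; exact hx.2.2.1 _,
      fun r s => by rw [← mul_assoc, mul_assoc]; exact hx.2.2.2 r _⟩)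

lemma mem_idealCore {R : Type*} [NonUnitalRing R] {W : AddSubgroup R} {x : R} :
    x ∈ idealCore W ↔
      x ∈ W ∧ (∀ r, r * x ∈ W) ∧ (∀ s, x * s ∈ W) ∧ ∀ r s, r * x * s ∈ W :=
  TwoSidedIdeal.mem_mk' ..

lemma idealCore_mem_nhds_zero {R : Type*} [NonUnitalRing R] [TopologicalSpace R]
    [IsTopologicalRing R] [CompactSpace R] {W : AddSubgroup R} (hW : IsOpen (W : Set R)) :
    (idealCore W : Set R) ∈ 𝓝 (0 : R) := by
  have key : ∀ {Y : Type _} [TopologicalSpace Y] [CompactSpace Y] (f : R → Y → R),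
      Continuous (Function.uncurry f) → (∀ y, f 0 y = 0) → ∀ᶠ x in 𝓝 (0 : R), ∀ y, f x y ∈ W := by
    intro Y _ _ f hf h0
    have := isCompact_univ.eventually_forall_of_forall_eventually (x₀ := (0 : R))
      (P := fun x (y : Y) => f x y ∈ W) fun y _ =>
        (hW.preimage hf).mem_nhds (by simp [Function.uncurry, h0])
    simpa using this
  filter_upwards [hW.mem_nhds W.zero_mem,
    key (fun x r => r * x) (by unfold Function.uncurry; fun_prop) (by simp),
    key (fun x s => x * s) (by unfold Function.uncurry; fun_prop) (by simp),
    key (fun x (p : R × R) => p.1 * x * p.2) (by unfold Function.uncurry; fun_prop) (by simp)]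
    with x h₁ h₂ h₃ h₄
  exact mem_idealCore.2 ⟨h₁, h₂, h₃, fun r s => h₄ (r, s)⟩

lemma TwoSidedIdeal.finite_quotient_of_mem_nhds_zero {R : Type*} [NonUnitalRing R]
    [TopologicalSpace R] [IsTopologicalRing R] [CompactSpace R] {I : TwoSidedIdeal R}
    (hI : (I : Set R) ∈ 𝓝 (0 : R)) : Finite I.ringCon.Quotient := by
  let N : AddSubgroup R :=
    { carrier := I, zero_mem' := I.zero_mem, add_mem' := I.add_mem, neg_mem' := I.neg_mem }
  have : Finite (R ⧸ N) := N.quotient_finite_of_isOpen (N.isOpen_of_mem_nhds hI)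
  let f : R ⧸ N → I.ringCon.Quotient := Quotient.lift (fun x => (x : I.ringCon.Quotient)) <| by
    intro x y hxy
    have hxy : -x + y ∈ I := QuotientAddGroup.leftRel_apply.1 hxy
    refine (RingCon.eq _).2 ((I.rel_iff x y).2 ?_)
    simpa [add_comm, sub_eq_add_neg] using I.neg_mem hxy
  refine Finite.of_surjective f fun q => ?_
  obtain ⟨x, rfl⟩ := Quotient.exists_rep q
  exact ⟨(x : R ⧸ N), rfl⟩

/-- If the left annihilator `U` of `g` is open and the orbit of `g` is nonmeagre, then all elements
near `0` are annihilated by `U`. The reason is that `U` also annihilates `h • g` for `h` near `1`. -/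
lemma IsCompactGRing.isOpen_rightAnnihilator {R G : Type*} [NonUnitalRing R] [TopologicalSpace R]
    [Group G] [TopologicalSpace G] [MulAction G R] (hR : IsCompactGRing R G) {g : R}
    (hg : ¬ IsMeagre (MulAction.orbit G g)) (hopen : IsOpen (leftAnnihilator g)) :
    IsOpen (rightAnnihilator (leftAnnihilator g) : Set R) := by
  have := hR.isTopologicalGroup
  have := hR.polishSpace
  have := hR.continuousSMul
  have := hR.isTopologicalRing
  have := hR.compactSpace
  have := hR.t2Space
  have hcpt : IsCompact (leftAnnihilator g) :=
    ((leftAnnihilatorAddSubgroup g).isClosed_of_isOpen hopen).isCompact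
  -- Near `1`, the inverse of `h` maps the compact open set `leftAnnihilator g` into itself.
  have hev : ∀ᶠ h in 𝓝 (1 : G), ∀ u ∈ leftAnnihilator g, h⁻¹ • u ∈ leftAnnihilator g :=
    hcpt.eventually_forall_of_forall_eventually fun u hu =>
      (hopen.preimage (by fun_prop : Continuous fun p : G × R => p.1⁻¹ • p.2)).mem_nhds
        (by simpa using hu)
  have hnm : ¬ IsMeagre (rightAnnihilator (leftAnnihilator g) : Set R) := by
    intro hm
    obtain ⟨V, hV, hVo, h1V⟩ := mem_nhds_iff.1 hev
    refine not_isMeagre_of_isOpen hVo ⟨1, h1V⟩ ((isMeagre_setOf_smul_mem hm hg).mono fun h hh => ?_)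
    refine mem_rightAnnihilator.2 fun u hu => ?_
    have hz : h⁻¹ • u * g = 0 := hV hh u hu
    have h0 : h • (0 : R) = 0 := by simpa using hR.smul_add h 0 0
    rw [← smul_inv_smul h u, ← hR.smul_mul, hz, h0]
  obtain ⟨x, hx⟩ : (interior (rightAnnihilator (leftAnnihilator g) : Set R)).Nonempty := by
    rw [nonempty_iff_ne_empty, Ne, ← (isClosed_rightAnnihilator _).isNowhereDense_iff]
    exact fun h => hnm h.isMeagre
  exact AddSubgroup.isOpen_of_mem_nhds _ (mem_interior_iff_mem_nhds.1 hx)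

theorem mainTheorem8 {R G : Type*} [NonUnitalRing R] [TopologicalSpace R]
    [Group G] [TopologicalSpace G] [MulAction G R]
    (hR : IsCompactGRing R G) (hsmall : IsSmallStructure R G)
    (A : Set R) (hA : A.Finite) (g : R) (hg : IsNMGenericOver G g A)
    (hopen : IsOpen (leftAnnihilator g)) :
    IsNullByFinite R := by
  have := hR.isTopologicalRing
  have := hR.compactSpace
  have hV := hR.isOpen_rightAnnihilator (hg.not_isMeagre_orbit hR hsmall hA) hopen
  let W := leftAnnihilatorAddSubgroup g ⊓ rightAnnihilator (leftAnnihilator g)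
  have hW : IsOpen (W : Set R) := hopen.inter hV
  exact ⟨idealCore W,
    fun x hx y hy => mem_rightAnnihilator.1 (mem_idealCore.1 hy).1.2 x (mem_idealCore.1 hx).1.1,
    TwoSidedIdeal.finite_quotient_of_mem_nhds_zero (idealCore_mem_nhds_zero hW)⟩
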